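/- Let $d\ge 0$ and $K\ge 3$. Let $\mathcal O$ be the open book with leaves $L_1,\dots,L_K$: the quotient of $([0,\infty)\times\mathbb R^d)\times\{1,\dots,K\}$ in which $(x,j)$ and $(x,k)$ are identified whenever $x^{(0)}=0$ (these points form the spine). For $x=(x^{(0)},x^{(1)},\dots,x^{(d)})$ put $Rx=(-x^{(0)},x^{(1)},\dots,x^{(d)})$, and equip $\mathcal O$ with the metric $$d\big((x,k),(y,j)\big)=|x-y|\ \text{ if } k=j,\qquad d\big((x,k),(y,j)\big)=|x-Ry|\ \text{ if } k\ne j .$$ For each $k$ let $F_k:\mathcal O\to\mathbb R^{d+1}$ be the folding map, $F_k(x,k)=x$ and $F_k(x,j)=Rx$ for $j\neq k$. Let $\mu$ be a Borel probability measure on $\mathcal O$ that is nondegenerate, i.e. $\mu(L_j^+)>0$ for every $j$, where $L_j^+=\{(x,j): x^{(0)}>0\}$, and square integrable, i.e. $\int_{\mathcal O} d(0,q)^2\,d\mu(q)<\infty$. Write $\tilde\mu_k=\mu\circ F_k^{-1}$ for the $k$-th folded measure on $\mathbb R^{d+1}$ and $m_k=\int_{\mathbb R^{d+1}} x^{(0)}\,d\tilde\mu_k(x)$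 for the first moment of $\mu$ on the leaf $L_k$. Let $\bar b=\operatorname{argmin}_{p\in\mathcal O}\int_{\mathcal O} d(p,q)^2\,d\mu(q)$ be the Fréchet mean of $\mu$. Let $p_1,p_2,\dots$ be independent random points of $\mathcal O$ on a probability space, each with law $\mu$, and for $N\ge 1$ let $b_N=\operatorname{argmin}_{p\in\mathcal O}\sum_{n=1}^N d(p,p_n)^2$ be the empirical Fréchet mean. (Both minimizers exist and are unique.) Theorem (Nonsticky CLT). Suppose that $m_k>0$ for some $k\in\{1,\dots,K\}$. Then $b_N$ is a (measurable) random point of $\mathcal O$ for every $N\ge1$, and the law $\tilde\nu_N$ of $\sqrt N\,(F_k b_N-F_k\bar b)$ on $\mathbb R^{d+1}$ converges weakly, as $N\to\infty$, to the Gaussian measure $\tilde g_k$ on $\mathbb R^{d+1}$ with mean $0$ and covariance matrix $$\tilde C_k=\int_{\mathbb R^{d+1}}(x-F_k\bar b)(x-F_k\bar b)^T\,d\tilde\mu_k(x);$$ that is, for every bounded continuous $\phi:\mathbb R^{d+1}\to\mathbb R$, $$\lim_{N\to\infty}\int_{\mathbb R^{d+1}}\phi\,d\tilde\nu_N=\int_{\mathbb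 R^{d+1}}\phi\,d\tilde g_k .$$ -/

import Mathlib

open MeasureTheory ProbabilityTheory Filter
open scoped Topology BoundedContinuousFunction

/-- The Euclidean space `ℝ^(d+1) = ℝ × ℝ^d`; coordinate `0` is the distinguished one. -/
abbrev Ambient (d : ℕ) : Type := EuclideanSpace ℝ (Fin (d + 1))

/-- The closed half-space `[0, ∞) × ℝ^d`. -/
abbrev ClosedHalfSpace (d : ℕ) : Type := {x : Ambient d // 0 ≤ x 0}

/-- Reflection across the hyperplane `{0} × ℝ^d`. -/
noncomputable def reflect {d : ℕ} (x : Ambient d) : Ambient d :=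
  WithLp.toLp 2 (fun i => if i = 0 then -x i else x i)

theorem reflect_zero {d : ℕ} (x : Ambient d) : reflect x 0 = -x 0 := by
  simp [reflect]

theorem reflect_succ {d : ℕ} (x : Ambient d) (i : Fin d) :
    reflect x i.succ = x i.succ := by
  simp [reflect, Fin.succ_ne_zero]

theorem ambient_ext {d : ℕ} {x y : Ambient d} (h0 : x 0 = y 0)
    (h : ∀ i : Fin d, x i.succ = y i.succ) : x = y := by
  ext i
  refine Fin.cases h0 h i

theorem norm_sub_sq_coord {d : ℕ} (x y : Ambient d) :
    ‖x - y‖ ^ 2 = (x 0 - y 0) ^ 2 + ∑ i : Fin d, (x i.succ - y i.succ) ^ 2 := by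
  rw [EuclideanSpace.real_norm_sq_eq, Fin.sum_univ_succ]
  simp

/-- Two points of the `K` copies of the half-space are identified when they are equal, or when
they are copies of the same boundary point. -/
def bookSetoid (d K : ℕ) : Setoid (ClosedHalfSpace d × Fin K) where
  r p q := p.1 = q.1 ∧ (p.2 = q.2 ∨ p.1.1 0 = 0)
  iseqv :=
    { refl := fun _ => ⟨rfl, Or.inl rfl⟩
      symm := fun {p q} h => ⟨h.1.symm, h.2.elim (fun e => Or.inl e.symm)
        (fun e => Or.inr (by rw [← h.1]; exact e))⟩
      trans := fun {p q r} h h' => by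
        refine ⟨h.1.trans h'.1, ?_⟩
        rcases h.2 with e | e
        · rcases h'.2 with e' | e'
          · exact Or.inl (e.trans e')
          · exact Or.inr (by rw [h.1]; exact e')
        · exact Or.inr e }

/-- The open book with `K` leaves of dimension `d + 1`, glued along the spine `ℝ^d`. -/
def OpenBook (d K : ℕ) : Type := Quotient (bookSetoid d K)

namespace OpenBook

variable {d K : ℕ}

/-- The point of the open book represented by `(x, k)`. -/
def mk (x : ClosedHalfSpace d) (k : Fin K) : OpenBook d K :=
  Quotient.mk (bookSetoid d K) (x, k)

theorem mk_eq_of_spine {x : ClosedHalfSpace d} (hx : x.1 0 = 0) (j k : Fin K) :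
    mk x j = mk x k :=
  Quotient.sound (s := bookSetoid d K) ⟨rfl, Or.inr hx⟩

theorem exists_rep (p : OpenBook d K) : ∃ x k, p = mk x k := by
  induction p using Quotient.inductionOn with
  | h a => exact ⟨a.1, a.2, rfl⟩

theorem reflect_eq_of_zero {x : Ambient d} (hx : x 0 = 0) : reflect x = x :=
  ambient_ext (by rw [reflect_zero, hx, neg_zero]) (fun i => reflect_succ x i)

/-- The `k`-th folding map: the leaf `k` goes identically to the upper half-space, all the other
leaves are reflected to the lower half-space. -/
noncomputable def fold (k : Fin K) : OpenBook d K → Ambient d :=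
  Quotient.lift (fun p : ClosedHalfSpace d × Fin K => if p.2 = k then p.1.1 else reflect p.1.1)
    (by
      rintro ⟨x, i⟩ ⟨y, j⟩ ⟨h1, h2⟩
      obtain rfl : x = y := h1
      rcases h2 with h | h
      · obtain rfl : i = j := h
        rfl
      · have : reflect x.1 = x.1 := reflect_eq_of_zero h
        simp [this])

theorem fold_mk (k j : Fin K) (x : ClosedHalfSpace d) :
    fold k (mk x j) = if j = k then x.1 else reflect x.1 := rfl

theorem fold_mk_self (k : Fin K) (x : ClosedHalfSpace d) : fold k (mk x k) = x.1 := by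
  simp [fold_mk]

theorem norm_reflect_sub_reflect (x y : Ambient d) : ‖reflect x - reflect y‖ = ‖x - y‖ := by
  refine (sq_eq_sq₀ (norm_nonneg _) (norm_nonneg _)).1 ?_
  rw [norm_sub_sq_coord, norm_sub_sq_coord]
  simp only [reflect_zero, reflect_succ]
  ring

theorem norm_reflect_sub (x y : Ambient d) : ‖reflect x - y‖ = ‖x - reflect y‖ := by
  refine (sq_eq_sq₀ (norm_nonneg _) (norm_nonneg _)).1 ?_
  rw [norm_sub_sq_coord, norm_sub_sq_coord]
  simp only [reflect_zero, reflect_succ]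
  ring

/-- The distance on the open book: `|x - y|` on the same leaf, `|x - R y|` on different leaves. -/
noncomputable instance : Dist (OpenBook d K) where
  dist := Quotient.lift₂
    (fun p q : ClosedHalfSpace d × Fin K =>
      if p.2 = q.2 then ‖p.1.1 - q.1.1‖ else ‖p.1.1 - reflect q.1.1‖)
    (by
      rintro ⟨x, i⟩ ⟨y, j⟩ ⟨x', i'⟩ ⟨y', j'⟩ ⟨h1, h2⟩ ⟨h3, h4⟩
      obtain rfl : x = x' := h1
      obtain rfl : y = y' := h3
      have hx : x.1 0 = 0 → ‖x.1 - reflect y.1‖ = ‖x.1 - y.1‖ := fun h => by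
        rw [← norm_reflect_sub, reflect_eq_of_zero h]
      have hy : y.1 0 = 0 → ‖x.1 - reflect y.1‖ = ‖x.1 - y.1‖ := fun h => by
        rw [reflect_eq_of_zero h]
      rcases h2 with h | h
      · obtain rfl : i = i' := h
        rcases h4 with h | h
        · obtain rfl : j = j' := h
          rfl
        · simp [hy h]
      · simp [hx h])

theorem dist_mk (x y : ClosedHalfSpace d) (k j : Fin K) :
    dist (mk x k) (mk y j) = if k = j then ‖x.1 - y.1‖ else ‖x.1 - reflect y.1‖ := rfl

theorem dist_mk_left (x : ClosedHalfSpace d) (k : Fin K) (q : OpenBook d K) :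
    dist (mk x k) q = ‖x.1 - fold k q‖ := by
  obtain ⟨y, j, rfl⟩ := exists_rep q
  rw [dist_mk, fold_mk]
  by_cases h : k = j
  · simp [h]
  · simp [h, Ne.symm h]

theorem dist_comm' (p q : OpenBook d K) : dist p q = dist q p := by
  obtain ⟨x, k, rfl⟩ := exists_rep p
  obtain ⟨y, j, rfl⟩ := exists_rep q
  rw [dist_mk, dist_mk]
  by_cases h : k = j
  · simp [h, norm_sub_rev]
  · rw [if_neg h, if_neg (Ne.symm h), ← norm_reflect_sub, norm_sub_rev]

theorem norm_fold_sub_le (k : Fin K) (p q : OpenBook d K) :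
    ‖fold k p - fold k q‖ ≤ dist p q := by
  obtain ⟨x, i, rfl⟩ := exists_rep p
  obtain ⟨y, j, rfl⟩ := exists_rep q
  rw [dist_mk, fold_mk, fold_mk]
  by_cases hij : i = j
  · subst hij
    by_cases hik : i = k
    · simp [hik]
    · simp [hik, norm_reflect_sub_reflect]
  · rw [if_neg hij]
    by_cases hik : i = k
    · have hjk : j ≠ k := fun h => hij (hik.trans h.symm)
      simp [hik, hjk]
    · by_cases hjk : j = k
      · simp [hik, hjk, norm_reflect_sub]
      · rw [if_neg hik, if_neg hjk, norm_reflect_sub_reflect]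
        refine (sq_le_sq₀ (norm_nonneg _) (norm_nonneg _)).1 ?_
        rw [norm_sub_sq_coord, norm_sub_sq_coord]
        simp only [reflect_zero, reflect_succ]
        nlinarith [mul_nonneg x.2 y.2]

noncomputable instance : MetricSpace (OpenBook d K) where
  dist_self p := by
    obtain ⟨x, k, rfl⟩ := exists_rep p
    simp [dist_mk]
  dist_comm := dist_comm'
  dist_triangle p q r := by
    obtain ⟨x, k, rfl⟩ := exists_rep p
    rw [dist_mk_left x k r, dist_mk_left x k q]
    exact (norm_sub_le_norm_sub_add_norm_sub _ (fold k q) _).trans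
      (by gcongr; exact norm_fold_sub_le k q r)
  eq_of_dist_eq_zero := by
    intro p q h
    obtain ⟨x, k, rfl⟩ := exists_rep p
    obtain ⟨y, j, rfl⟩ := exists_rep q
    rw [dist_mk] at h
    by_cases hkj : k = j
    · subst hkj
      rw [if_pos rfl, norm_sub_eq_zero_iff] at h
      rw [Subtype.ext h]
    · rw [if_neg hkj, norm_sub_eq_zero_iff] at h
      have h0 : x.1 0 = -y.1 0 := by rw [h, reflect_zero]
      have hx := x.2
      have hy := y.2
      have hy0 : y.1 0 = 0 := by linarith
      rw [reflect_eq_of_zero hy0] at h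
      rw [Subtype.ext h]
      exact mk_eq_of_spine hy0 k j

noncomputable instance : MeasurableSpace (OpenBook d K) := borel _

instance : BorelSpace (OpenBook d K) := ⟨rfl⟩

/-- The origin of the open book: the point `(0, k)`, which does not depend on `k`. -/
def origin (k : Fin K) : OpenBook d K := mk ⟨0, le_refl _⟩ k

theorem origin_eq (j k : Fin K) : (origin j : OpenBook d K) = origin k :=
  mk_eq_of_spine rfl j k

/-- The open leaf `L_k^+`: the `k`-th leaf without the spine. -/
def openLeaf (k : Fin K) : Set (OpenBook d K) :=
  {p | ∃ x : ClosedHalfSpace d, 0 < x.1 0 ∧ p = mk x k}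

/-- The folded measure: the push-forward of `μ` under the `k`-th folding map. -/
noncomputable def foldedMeasure (μ : Measure (OpenBook d K)) (k : Fin K) :
    Measure (Ambient d) :=
  μ.map (fold k)

/-- The first moment of `μ` on the `k`-th leaf. -/
noncomputable def firstMoment (μ : Measure (OpenBook d K)) (k : Fin K) : ℝ :=
  ∫ x, x 0 ∂(foldedMeasure μ k)

/-- The covariance matrix `∫ (x - c) (x - c)^T dμ̃_k(x)` of the `k`-th folded measure about `c`. -/
noncomputable def foldedCovariance (μ : Measure (OpenBook d K)) (k : Fin K) (c : Ambient d) :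
    Matrix (Fin (d + 1)) (Fin (d + 1)) ℝ :=
  Matrix.of fun i j => ∫ x, (x i - c i) * (x j - c j) ∂(foldedMeasure μ k)

/-- `b` minimizes `b ↦ ∑ n < N, d(b, p_n)^2`. -/
def IsBarycenter (p : ℕ → OpenBook d K) (N : ℕ) (b : OpenBook d K) : Prop :=
  ∀ q, ∑ n ∈ Finset.range N, dist b (p n) ^ 2 ≤ ∑ n ∈ Finset.range N, dist q (p n) ^ 2

/-- `b` minimizes `b ↦ ∫ d(b, q)^2 dμ(q)`. -/
def IsFrechetMean (μ : Measure (OpenBook d K)) (b : OpenBook d K) : Prop :=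
  ∀ p, ∫ q, dist b q ^ 2 ∂μ ≤ ∫ q, dist p q ^ 2 ∂μ

/-- The barycenter of the first `N` terms `p 0, …, p (N - 1)` of a sequence. For `N ≥ 1` it is
the only point that satisfies `IsBarycenter p N`: see `isBarycenter_iff`. -/
noncomputable def barycenter (p : ℕ → OpenBook d K) (N : ℕ) : OpenBook d K :=
  @Classical.epsilon _ ⟨p 0⟩ (IsBarycenter p N)

/-- The Fréchet mean of `μ`. If `μ` is a probability measure with finite second moment, it is
the only point that satisfies `IsFrechetMean μ`: see `isFrechetMean_iff`. -/
noncomputable def frechetMean (μ : Measure (OpenBook d K)) [NeZero μ] : OpenBook d K :=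
  @Classical.epsilon _ μ.nonempty_of_neZero (IsFrechetMean μ)

theorem lipschitzWith_fold (k : Fin K) : LipschitzWith 1 (fold k : OpenBook d K → Ambient d) :=
  LipschitzWith.of_dist_le_mul fun p q => by
    rw [dist_eq_norm, NNReal.coe_one, one_mul]
    exact norm_fold_sub_le k p q

theorem fold_succ (j k : Fin K) (q : OpenBook d K) (i : Fin d) :
    fold j q i.succ = fold k q i.succ := by
  obtain ⟨x, l, rfl⟩ := exists_rep q
  rw [fold_mk, fold_mk]
  split_ifs <;> simp [reflect_succ]

theorem fold_zero_add_nonpos {j k : Fin K} (h : j ≠ k) (q : OpenBook d K) :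
    fold j q 0 + fold k q 0 ≤ 0 := by
  obtain ⟨x, l, rfl⟩ := exists_rep q
  have := x.2
  rw [fold_mk, fold_mk]
  split_ifs with h1 h2 h2
  · exact absurd (h1.symm.trans h2) h
  · simp [reflect_zero]
  · simp [reflect_zero]
  · simp only [reflect_zero]; linarith

theorem norm_fold (k : Fin K) (q : OpenBook d K) : ‖fold k q‖ = dist (origin k) q := by
  rw [origin, dist_mk_left]
  simp

/-- The integral of the squared distance, as a quadratic polynomial on each leaf. -/
theorem integral_dist_sq (ν : Measure (OpenBook d K)) [IsFiniteMeasure ν] (k₀ : Fin K)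
    (hν : Integrable (fun q => dist (origin k₀) q ^ 2) ν) (x : ClosedHalfSpace d) (k : Fin K) :
    ∫ q, dist (mk x k) q ^ 2 ∂ν =
      ν.real Set.univ * (x.1 0 ^ 2 + ∑ i : Fin d, x.1 i.succ ^ 2)
        - 2 * (x.1 0 * ∫ q, fold k q 0 ∂ν
          + ∑ i : Fin d, x.1 i.succ * ∫ q, fold k₀ q i.succ ∂ν)
        + ∫ q, dist (origin k₀) q ^ 2 ∂ν := by
  have hmem : MemLp (fold k : OpenBook d K → Ambient d) 2 ν := by
    rw [← memLp_norm_iff (lipschitzWith_fold k).continuous.aestronglyMeasurable,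
      memLp_two_iff_integrable_sq
        (lipschitzWith_fold k).continuous.norm.aestronglyMeasurable]
    simpa only [norm_fold, origin_eq k k₀] using hν
  have hF : Integrable (fold k : OpenBook d K → Ambient d) ν := hmem.integrable one_le_two
  have hi : ∀ i, Integrable (fun q => fold k q i) ν := fun i =>
    (EuclideanSpace.proj (𝕜 := ℝ) i).integrable_comp hF
  have hpt : ∀ q, dist (mk x k) q ^ 2 =
      (x.1 0 ^ 2 + ∑ i : Fin d, x.1 i.succ ^ 2)
        - 2 * (x.1 0 * fold k q 0 + ∑ i : Fin d, x.1 i.succ * fold k q i.succ)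
        + dist (origin k₀) q ^ 2 := by
    intro q
    rw [dist_mk_left, origin_eq k₀ k, ← norm_fold, norm_sub_sq_coord,
      ← sub_zero (fold k q), norm_sub_sq_coord (fold k q) 0]
    simp only [sub_zero, PiLp.zero_apply, sub_sq, Finset.sum_add_distrib, Finset.sum_sub_distrib,
      mul_add, Finset.mul_sum]
    ring_nf
  have hs : Integrable (fun q => ∑ i : Fin d, x.1 i.succ * fold k q i.succ) ν :=
    integrable_finsetSum _ fun i _ => (hi i.succ).const_mul _
  have h1 : Integrable
      (fun q => x.1 0 * fold k q 0 + ∑ i : Fin d, x.1 i.succ * fold k q i.succ) ν :=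
    ((hi 0).const_mul _).add hs
  have h2 : Integrable (fun q => (x.1 0 ^ 2 + ∑ i : Fin d, x.1 i.succ ^ 2)
      - 2 * (x.1 0 * fold k q 0 + ∑ i : Fin d, x.1 i.succ * fold k q i.succ)) ν :=
    (integrable_const _).sub (h1.const_mul 2)
  simp_rw [hpt]
  rw [integral_add h2 hν,
    integral_sub (integrable_const _) (h1.const_mul 2), integral_const, integral_const_mul,
    integral_add ((hi 0).const_mul _) hs, integral_const_mul,
    integral_finsetSum _ fun i _ => (hi i.succ).const_mul _]
  simp_rw [integral_const_mul, fold_succ k k₀, smul_eq_mul]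

/-- The squared distance has exactly one minimizer in mean. -/
theorem exists_strict_min (ν : Measure (OpenBook d K)) [IsFiniteMeasure ν] [NeZero ν]
    (k₀ : Fin K) (hν : Integrable (fun q => dist (origin k₀) q ^ 2) ν) :
    ∃ b : OpenBook d K, ∀ p, p ≠ b → ∫ q, dist b q ^ 2 ∂ν < ∫ q, dist p q ^ 2 ∂ν := by
  set w := ν.real Set.univ with hw
  have hwpos : 0 < w := measureReal_univ_pos
  set M : Fin K → ℝ := fun k => ∫ q, fold k q 0 ∂ν with hM
  set s : Fin d → ℝ := fun i => ∫ q, fold k₀ q i.succ ∂ν with hs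
  set A := ∫ q, dist (origin k₀) q ^ 2 ∂ν
  have hV : ∀ (x : ClosedHalfSpace d) (k : Fin K), w * ∫ q, dist (mk x k) q ^ 2 ∂ν =
      ((w * x.1 0) ^ 2 - 2 * (w * x.1 0) * M k) + ∑ i : Fin d, (w * x.1 i.succ - s i) ^ 2
        + (w * A - ∑ i : Fin d, s i ^ 2) := by
    intro x k
    rw [integral_dist_sq ν k₀ hν x k]
    simp only [sub_sq, Finset.sum_add_distrib, Finset.sum_sub_distrib, mul_add, mul_sub,
      Finset.mul_sum]
    have e2 : ∑ i : Fin d, 2 * (w * x.1 i.succ) * s i = ∑ i : Fin d, w * (2 * (x.1 i.succ * s i)) :=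
      Finset.sum_congr rfl fun i _ => by ring
    have e3 : ∑ i : Fin d, w * (w * x.1 i.succ ^ 2) = ∑ i : Fin d, (w * x.1 i.succ) ^ 2 :=
      Finset.sum_congr rfl fun i _ => by ring
    rw [e2, e3]
    ring
  have hpair : ∀ j k, j ≠ k → M j + M k ≤ 0 := by
    intro j k hjk
    have hint : ∀ l : Fin K, Integrable (fun q => fold l q 0) ν := fun l => by
      have hmem : MemLp (fold l : OpenBook d K → Ambient d) 2 ν := by
        rw [← memLp_norm_iff (lipschitzWith_fold l).continuous.aestronglyMeasurable,
          memLp_two_iff_integrable_sq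
            (lipschitzWith_fold l).continuous.norm.aestronglyMeasurable]
        simpa only [norm_fold, origin_eq l k₀] using hν
      exact (EuclideanSpace.proj (𝕜 := ℝ) 0).integrable_comp (hmem.integrable one_le_two)
    rw [hM]
    dsimp only
    rw [← integral_add (hint j) (hint k)]
    exact integral_nonpos fun q => fold_zero_add_nonpos hjk q
  -- the minimizer, with first coordinate `t` on the leaf `k`
  have key : ∀ (t : ℝ) (ht : 0 ≤ t) (k : Fin K),
      (∀ (y : ClosedHalfSpace d) (j : Fin K),
        (w * t) ^ 2 - 2 * (w * t) * M k ≤ (w * y.1 0) ^ 2 - 2 * (w * y.1 0) * M j ∧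
        ((w * t) ^ 2 - 2 * (w * t) * M k = (w * y.1 0) ^ 2 - 2 * (w * y.1 0) * M j →
          y.1 0 = t ∧ (j = k ∨ t = 0))) →
      ∃ b : OpenBook d K, ∀ p, p ≠ b → ∫ q, dist b q ^ 2 ∂ν < ∫ q, dist p q ^ 2 ∂ν := by
    intro t ht k hmin
    set b : Ambient d := WithLp.toLp 2 (Fin.cons t fun i => s i / w) with hb
    have hb0 : b 0 = t := by simp [hb]
    have hbs : ∀ i : Fin d, b i.succ = s i / w := fun i => by simp [hb]
    refine ⟨mk ⟨b, by rw [hb0]; exact ht⟩ k, fun p hp => ?_⟩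
    obtain ⟨y, j, rfl⟩ := exists_rep p
    refine lt_of_mul_lt_mul_left ?_ hwpos.le
    rw [hV, hV]
    have hz : ∑ i : Fin d, (w * b i.succ - s i) ^ 2 = 0 :=
      Finset.sum_eq_zero fun i _ => by rw [hbs, mul_div_cancel₀ _ hwpos.ne', sub_self]; simp
    have hnn : 0 ≤ ∑ i : Fin d, (w * y.1 i.succ - s i) ^ 2 :=
      Finset.sum_nonneg fun i _ => sq_nonneg _
    dsimp only
    rw [hz, hb0]
    obtain ⟨h1, h2⟩ := hmin y j
    by_contra hcon
    have hS : ∑ i : Fin d, (w * y.1 i.succ - s i) ^ 2 = 0 := by linarith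
    obtain ⟨h3, h4⟩ := h2 (by linarith)
    have hyb : y = ⟨b, by rw [hb0]; exact ht⟩ := by
      refine Subtype.ext (ambient_ext (by rw [h3]; exact hb0.symm) fun i => ?_)
      have := (Finset.sum_eq_zero_iff_of_nonneg fun i _ => sq_nonneg _).1 hS i
        (Finset.mem_univ i)
      change y.1 i.succ = b i.succ
      rw [hbs, eq_div_iff hwpos.ne']
      nlinarith [pow_eq_zero_iff (two_ne_zero) |>.1 this]
    refine hp ?_
    rw [hyb]
    rcases h4 with rfl | h4
    · rfl
    · exact mk_eq_of_spine (by change b 0 = 0; rw [hb0, h4]) j k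
  by_cases hex : ∃ k, 0 < M k
  · obtain ⟨k, hk⟩ := hex
    refine key (M k / w) (by positivity) k fun y j => ?_
    rw [mul_div_cancel₀ _ hwpos.ne']
    have hy : 0 ≤ w * y.1 0 := mul_nonneg hwpos.le y.2
    by_cases hjk : j = k
    · subst hjk
      refine ⟨by nlinarith [sq_nonneg (w * y.1 0 - M j)], fun h => ⟨?_, Or.inl rfl⟩⟩
      have : (w * y.1 0 - M j) ^ 2 = 0 := by linarith
      rw [eq_div_iff hwpos.ne']
      linarith [pow_eq_zero_iff (two_ne_zero) |>.1 this]
    · have := hpair j k hjk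
      have hlt : M k ^ 2 - 2 * M k * M k < (w * y.1 0) ^ 2 - 2 * (w * y.1 0) * M j := by
        nlinarith [mul_nonneg hy (by linarith : 0 ≤ -M j), sq_nonneg (w * y.1 0)]
      exact ⟨hlt.le, fun h => absurd h hlt.ne⟩
  · push Not at hex
    refine key 0 le_rfl k₀ fun y j => ?_
    have hy : 0 ≤ w * y.1 0 := mul_nonneg hwpos.le y.2
    have h1 := mul_nonneg hy (by linarith [hex j] : 0 ≤ -M j)
    refine ⟨by nlinarith [sq_nonneg (w * y.1 0)], fun h => ⟨?_, Or.inr rfl⟩⟩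
    have : (w * y.1 0) ^ 2 = 0 := by nlinarith [sq_nonneg (w * y.1 0)]
    exact (mul_eq_zero.1 (pow_eq_zero_iff (two_ne_zero) |>.1 this)).resolve_left hwpos.ne'

theorem isFrechetMean_iff (μ : Measure (OpenBook d K)) [IsFiniteMeasure μ] [NeZero μ]
    (k₀ : Fin K) (hμ : Integrable (fun q => dist (origin k₀) q ^ 2) μ) (b : OpenBook d K) :
    IsFrechetMean μ b ↔ b = frechetMean μ := by
  obtain ⟨c, hc⟩ := exists_strict_min μ k₀ hμ
  have h : ∀ b, IsFrechetMean μ b ↔ b = c := fun b =>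
    ⟨fun hb => by_contra fun hne => absurd (hb c) (not_le.2 (hc b hne)),
      fun hb p => by
        subst hb
        by_cases hp : p = b
        · rw [hp]
        · exact (hc p hp).le⟩
  have h' : IsFrechetMean μ (frechetMean μ) :=
    Classical.epsilon_spec (p := IsFrechetMean μ) ⟨c, (h c).2 rfl⟩
  rw [h, (h _).1 h']

theorem isBarycenter_iff (p : ℕ → OpenBook d K) {N : ℕ} (hN : 1 ≤ N) (b : OpenBook d K) :
    IsBarycenter p N b ↔ b = barycenter p N := by
  obtain ⟨_, k₀, _⟩ := exists_rep (p 0)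
  set ν : Measure (OpenBook d K) := ∑ n ∈ Finset.range N, Measure.dirac (p n) with hνdef
  have hint : ∀ q, ∫ r, dist q r ^ 2 ∂ν = ∑ n ∈ Finset.range N, dist q (p n) ^ 2 := by
    intro q
    rw [hνdef, integral_finsetSum_measure fun n _ => integrable_dirac (by simp)]
    simp
  have hne : NeZero ν := ⟨fun h => by
    have h1 : ν Set.univ = N := by simp [hνdef]
    rw [h] at h1
    simp only [Measure.coe_zero, Pi.zero_apply] at h1
    have : N = 0 := by exact_mod_cast h1.symm
    omega⟩
  obtain ⟨c, hc⟩ := exists_strict_min ν k₀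
    (integrable_finsetSum_measure.2 fun n _ => integrable_dirac (by simp))
  simp only [hint] at hc
  have h : ∀ b, IsBarycenter p N b ↔ b = c := fun b =>
    ⟨fun hb => by_contra fun hne => absurd (hb c) (not_le.2 (hc b hne)),
      fun hb q => by
        subst hb
        by_cases hq : q = b
        · rw [hq]
        · exact (hc q hq).le⟩
  have h' : IsBarycenter p N (barycenter p N) :=
    Classical.epsilon_spec (p := IsBarycenter p N) ⟨c, (h c).2 rfl⟩
  rw [h, (h _).1 h']

end OpenBook

/-! Seen from the leaf `k`, the distance to `q` is the Euclidean distance to `fold k q`, so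
minimizing the mean squared distance over that leaf is a Euclidean problem, solved by projecting the
folded mean onto the half-space. For distinct leaves the first coordinates of the two foldings of a
point sum to at most `0`, so at most one first moment is positive. If that of the leaf `k` is
positive, the minimizer lies on this leaf, the projection does nothing, and the folded Fréchet mean
is the ordinary mean of the folded measure (`fold_frechetMean`).

The argument is run for any nonzero finite measure (`isFrechetMean_mk_halfSpaceProj`), so it also
covers the sum of the Dirac masses at the sample points: `fold_barycenter` gives the ordinary
average whenever the empirical first moment is positive. By the strong law this holds almost surely
for all large `N` (`ae_eventually_fold_barycenter`). The rescaled folded barycenter then coincides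
eventually with a normalized sum of i.i.d. square-integrable vectors, and the multivariate central
limit theorem with Slutsky's lemma concludes. -/

/-- The covariance matrix of a random vector. -/
noncomputable def covarianceMatrix {Ω ι : Type*} [MeasurableSpace Ω] (P : Measure Ω)
    (X : Ω → EuclideanSpace ℝ ι) : Matrix ι ι ℝ :=
  Matrix.of fun i j => cov[fun ω => X ω i, fun ω => X ω j; P]

/-! ### The multivariate central limit theorem, by the Cramér–Wold device. -/

section CentralLimitTheorem

variable {Ω ι : Type*} [MeasurableSpace Ω] {P : Measure Ω} [Fintype ι]

theorem memLp_apply {X : Ω → EuclideanSpace ℝ ι} (hX : MemLp X 2 P) (i : ι) :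
    MemLp (fun ω => X ω i) 2 P :=
  (EuclideanSpace.proj (𝕜 := ℝ) i).comp_memLp' hX

/-- The Cramér–Wold reduction: a characteristic function involves only one-dimensional projections,
and the frequency `t` can be absorbed into the projection. -/
theorem charFun_map_eq_charFun_map_inner_one {E : Type*} [NormedAddCommGroup E]
    [InnerProductSpace ℝ E] [MeasurableSpace E] [BorelSpace E] {Y : Ω → E} (hY : AEMeasurable Y P)
    (t : E) : charFun (P.map Y) t = charFun (P.map fun ω => inner ℝ (Y ω) t) 1 := by
  have h : Continuous fun x : E => inner ℝ x t := by fun_prop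
  have hcomp : (P.map fun ω => inner ℝ (Y ω) t) = (P.map Y).map fun x => inner ℝ x t :=
    (AEMeasurable.map_map_of_aemeasurable h.aemeasurable hY).symm
  rw [hcomp, charFun_apply, charFun_apply, integral_map h.aemeasurable (by fun_prop)]
  simp

variable [IsProbabilityMeasure P]

theorem dotProduct_covarianceMatrix_mulVec {X : Ω → EuclideanSpace ℝ ι} (hX : MemLp X 2 P)
    (t : ι → ℝ) :
    dotProduct t ((covarianceMatrix P X).mulVec t) = Var[fun ω => ∑ i, t i * X ω i; P] := by
  have h : ∀ i, MemLp (fun ω => t i * X ω i) 2 P := fun i => (memLp_apply hX i).const_mul _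
  rw [variance_fun_sum h]
  simp only [dotProduct, Matrix.mulVec, covarianceMatrix, Matrix.of_apply, Finset.mul_sum]
  refine Finset.sum_congr rfl fun i _ => Finset.sum_congr rfl fun j _ => ?_
  rw [covariance_const_mul_left, covariance_const_mul_right]
  ring

/-- The quadratic form is a variance. This is what the formula for the characteristic function of
`multivariateGaussian` requires. -/
theorem posSemidef_covarianceMatrix {X : Ω → EuclideanSpace ℝ ι} (hX : MemLp X 2 P) :
    (covarianceMatrix P X).PosSemidef := by
  refine .of_dotProduct_mulVec_nonneg (Matrix.ext fun i j => ?_) fun t => ?_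
  · simp [covarianceMatrix, covariance_comm]
  · rw [star_trivial, dotProduct_covarianceMatrix_mulVec hX]
    exact variance_nonneg _ _

/-- The multivariate central limit theorem. -/
theorem tendstoInDistribution_inv_sqrt_smul_sum_sub [DecidableEq ι]
    {X : ℕ → Ω → EuclideanSpace ℝ ι} (hX : MemLp (X 0) 2 P) (hindep : iIndepFun X P)
    (hident : ∀ n, IdentDistrib (X n) (X 0) P P) :
    TendstoInDistribution
      (fun (n : ℕ) ω => (√(n : ℝ))⁻¹ • (∑ k ∈ Finset.range n, X k ω - (n : ℝ) • P[X 0]))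
      atTop id (fun _ => P) (multivariateGaussian 0 (covarianceMatrix P (X 0))) := by
  have hXm : ∀ n, AEMeasurable (X n) P := fun n => (hident n).aemeasurable_fst
  have hm : ∀ n : ℕ, AEMeasurable
      (fun ω => (√(n : ℝ))⁻¹ • (∑ k ∈ Finset.range n, X k ω - (n : ℝ) • P[X 0])) P := fun n =>
    ((Finset.aemeasurable_fun_sum _ fun _ _ => hXm _).sub_const _).fun_const_smul _
  refine ⟨hm, aemeasurable_id, ProbabilityMeasure.tendsto_iff_tendsto_charFun.2 fun t => ?_⟩
  have hinner : Continuous fun x : EuclideanSpace ℝ ι => inner ℝ x t := by fun_prop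
  set Z : ℕ → Ω → ℝ := fun n ω => inner ℝ (X n ω) t with hZ
  have hZ0 : MemLp (Z 0) 2 P := by
    have := (innerSL ℝ t).comp_memLp' hX
    simpa [Function.comp_def, hZ, real_inner_comm] using this
  -- The scalar theorem for the projections on `t`; the limit is realized as the identity on `ℝ`
  -- under the Gaussian law.
  have hclt := ProbabilityTheory.tendstoInDistribution_inv_sqrt_mul_sum_sub (X := Z)
    (HasLaw.id (μ := gaussianReal 0 Var[Z 0; P].toNNReal)) hZ0
    (hindep.comp (fun _ x => inner ℝ x t) fun _ => hinner.measurable)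
    (fun n => (hident n).comp hinner.measurable)
  -- Frequency `1` suffices, since `t` is already part of `Z`.
  have h1 := ProbabilityMeasure.tendsto_iff_tendsto_charFun.1 hclt.tendsto 1
  have hmean : P[Z 0] = inner ℝ (P[X 0]) t := by
    rw [real_inner_comm, ← integral_inner (hX.integrable one_le_two)]
    simp only [hZ, real_inner_comm]
  have hvar : dotProduct t.ofLp ((covarianceMatrix P (X 0)).mulVec t.ofLp) = Var[Z 0; P] := by
    rw [dotProduct_covarianceMatrix_mulVec hX]
    simp [hZ, PiLp.inner_apply]
  convert h1 using 2
  · simp only [ProbabilityMeasure.coe_mk]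
    rw [charFun_map_eq_charFun_map_inner_one (hm _)]
    congr 2
    ext ω
    simp [hZ, ← hmean, inner_smul_left, inner_sub_left, sum_inner]
  · simp only [ProbabilityMeasure.coe_mk, Measure.map_id]
    rw [charFun_multivariateGaussian (posSemidef_covarianceMatrix hX), charFun_gaussianReal, hvar,
      Real.coe_toNNReal _ (variance_nonneg _ _)]
    simp

end CentralLimitTheorem

/-! ### Minimizers in folded coordinates. -/

namespace OpenBook

variable {d K : ℕ}

/-- The projection of the ambient space onto the closed half-space. -/
noncomputable def halfSpaceProj (y : Ambient d) : ClosedHalfSpace d :=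
  ⟨WithLp.toLp 2 fun i => if i = 0 then max (y i) 0 else y i, by simp⟩

theorem halfSpaceProj_zero (y : Ambient d) : (halfSpaceProj y).1 0 = max (y 0) 0 := by
  simp [halfSpaceProj]

theorem halfSpaceProj_succ (y : Ambient d) (i : Fin d) :
    (halfSpaceProj y).1 i.succ = y i.succ := by
  simp [halfSpaceProj, Fin.succ_ne_zero]

theorem halfSpaceProj_of_nonneg {y : Ambient d} (hy : 0 ≤ y 0) : (halfSpaceProj y).1 = y :=
  ambient_ext (by rw [halfSpaceProj_zero, max_eq_left hy]) fun i => halfSpaceProj_succ y i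

theorem measurable_halfSpaceProj :
    Measurable (halfSpaceProj : Ambient d → ClosedHalfSpace d) := by
  refine Measurable.subtype_mk ?_
  refine (WithLp.measurable_toLp 2 _).comp (measurable_pi_lambda _ fun i => ?_)
  split_ifs <;> fun_prop

theorem continuous_mk (k : Fin K) : Continuous fun x : ClosedHalfSpace d => mk x k :=
  (Isometry.of_dist_eq fun x y => by
    rw [dist_mk, if_pos rfl, Subtype.dist_eq, dist_eq_norm]).continuous

theorem memLp_fold {ν : Measure (OpenBook d K)} {k₀ : Fin K}
    (hν : Integrable (fun q => dist (origin k₀) q ^ 2) ν) (k : Fin K) :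
    MemLp (fold k : OpenBook d K → Ambient d) 2 ν := by
  rw [← memLp_norm_iff (lipschitzWith_fold k).continuous.aestronglyMeasurable,
    memLp_two_iff_integrable_sq (lipschitzWith_fold k).continuous.norm.aestronglyMeasurable]
  simpa only [norm_fold, origin_eq k k₀] using hν

variable {ν : Measure (OpenBook d K)} [IsFiniteMeasure ν]

theorem integrable_fold {k₀ : Fin K} (hν : Integrable (fun q => dist (origin k₀) q ^ 2) ν)
    (k : Fin K) : Integrable (fold k : OpenBook d K → Ambient d) ν :=
  (memLp_fold hν k).integrable one_le_two

theorem integral_fold_apply {k₀ : Fin K}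
    (hν : Integrable (fun q => dist (origin k₀) q ^ 2) ν) (k : Fin K) (i : Fin (d + 1)) :
    (∫ q, fold k q ∂ν) i = ∫ q, fold k q i ∂ν :=
  ((EuclideanSpace.proj (𝕜 := ℝ) i).integral_comp_comm (integrable_fold hν k)).symm

/-- At most one leaf has a positive first moment. -/
theorem integral_fold_zero_neg {j k : Fin K} (hjk : j ≠ k)
    (hν : Integrable (fun q => dist (origin k) q ^ 2) ν)
    (hk : 0 < (∫ q, fold k q ∂ν) 0) : (∫ q, fold j q ∂ν) 0 < 0 := by
  have hint : ∀ l : Fin K, Integrable (fun q => fold l q 0) ν := fun l =>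
    (EuclideanSpace.proj (𝕜 := ℝ) 0).integrable_comp (integrable_fold hν l)
  have h : ∫ q, (fold j q 0 + fold k q 0) ∂ν ≤ 0 :=
    integral_nonpos fun q => fold_zero_add_nonpos hjk q
  rw [integral_add (hint j) (hint k), ← integral_fold_apply hν, ← integral_fold_apply hν] at h
  linarith

/-- The minimizer lies on the leaf with the largest first moment. -/
theorem isFrechetMean_mk_halfSpaceProj [NeZero ν] {k : Fin K}
    (hν : Integrable (fun q => dist (origin k) q ^ 2) ν)
    (hk : ∀ j, (∫ q, fold j q ∂ν) 0 ≤ (∫ q, fold k q ∂ν) 0) :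
    IsFrechetMean ν (mk (halfSpaceProj ((ν.real Set.univ)⁻¹ • ∫ q, fold k q ∂ν)) k) := by
  intro p
  obtain ⟨x, j, rfl⟩ := exists_rep p
  rw [integral_dist_sq ν k hν, integral_dist_sq ν k hν]
  simp only [← integral_fold_apply hν, halfSpaceProj_zero, halfSpaceProj_succ, PiLp.smul_apply,
    smul_eq_mul]
  set w := ν.real Set.univ
  have hw : 0 < w := measureReal_univ_pos
  set m := ∫ q, fold k q ∂ν
  have hkj := mul_le_mul_of_nonneg_left (hk j) x.2
  set M := (∫ q, fold j q ∂ν) 0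
  -- The spine coordinates decouple and do not depend on the leaf; each is settled by completing the
  -- square.
  have htail : w * ∑ i : Fin d, (w⁻¹ * m i.succ) ^ 2 - 2 * ∑ i : Fin d, w⁻¹ * m i.succ * m i.succ ≤
      w * ∑ i : Fin d, x.1 i.succ ^ 2 - 2 * ∑ i : Fin d, x.1 i.succ * m i.succ := by
    simp only [Finset.mul_sum, ← Finset.sum_sub_distrib]
    refine Finset.sum_le_sum fun i _ => ?_
    obtain ⟨c, hc⟩ : ∃ c, w⁻¹ * m i.succ = c := ⟨_, rfl⟩
    have hm : m i.succ = w * c := by rw [← hc]; field_simp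
    rw [hc, hm]
    nlinarith [mul_nonneg hw.le (sq_nonneg (x.1 i.succ - c))]
  -- Since `x.1 0 ≥ 0`, `hkj` allows `M` to be replaced by the larger moment of the leaf `k`. What
  -- remains is a parabola with vertex `c` on the half-line, minimized at `max c 0`.
  have hhead : w * max (w⁻¹ * m 0) 0 ^ 2 - 2 * (max (w⁻¹ * m 0) 0 * m 0) ≤
      w * x.1 0 ^ 2 - 2 * (x.1 0 * M) := by
    obtain ⟨c, hc⟩ : ∃ c, w⁻¹ * m 0 = c := ⟨_, rfl⟩
    have hm : m 0 = w * c := by rw [← hc]; field_simp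
    rw [hm] at hkj
    rw [hc, hm]
    have hx := x.2
    rcases le_total c 0 with h | h
    · rw [max_eq_right h]
      nlinarith [mul_nonneg hw.le (sq_nonneg (x.1 0)), mul_nonneg (mul_nonneg hw.le hx)
        (neg_nonneg.2 h)]
    · rw [max_eq_left h]
      nlinarith [mul_nonneg hw.le (sq_nonneg (x.1 0 - c))]
  linarith

/-- All other leaves have negative first moment, so the leaf `k` carries the minimizer, and the
folded mean is already in the half-space. -/
theorem fold_frechetMean {μ : Measure (OpenBook d K)} [IsProbabilityMeasure μ] {k : Fin K}
    (hμ : Integrable (fun q => dist (origin k) q ^ 2) μ) (hk : 0 < (∫ q, fold k q ∂μ) 0) :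
    fold k (frechetMean μ) = ∫ q, fold k q ∂μ := by
  have h := isFrechetMean_mk_halfSpaceProj hμ fun j => by
    by_cases hjk : j = k
    · rw [hjk]
    · exact ((integral_fold_zero_neg hjk hμ hk).trans hk).le
  rw [← (isFrechetMean_iff μ k hμ _).1 h, fold_mk_self, probReal_univ, inv_one, one_smul,
    halfSpaceProj_of_nonneg hk.le]

/-! ### Empirical barycenters as minimizers for sums of Dirac masses. -/

section Barycenter

variable {p : ℕ → OpenBook d K} {N : ℕ}

theorem integrable_sum_dirac {E : Type*} [NormedAddCommGroup E] (f : OpenBook d K → E)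
    (p : ℕ → OpenBook d K) (N : ℕ) :
    Integrable f (∑ n ∈ Finset.range N, Measure.dirac (p n)) :=
  integrable_finsetSum_measure.2 fun _ _ => integrable_dirac (by simp)

theorem integral_sum_dirac {E : Type*} [NormedAddCommGroup E] [NormedSpace ℝ E] [CompleteSpace E]
    (f : OpenBook d K → E) (p : ℕ → OpenBook d K) (N : ℕ) :
    ∫ q, f q ∂(∑ n ∈ Finset.range N, Measure.dirac (p n)) = ∑ n ∈ Finset.range N, f (p n) := by
  rw [integral_finsetSum_measure fun n _ => integrable_dirac (by simp)]
  simp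

theorem barycenter_eq_mk (hN : 1 ≤ N) {k : Fin K}
    (hk : ∀ j, (∑ n ∈ Finset.range N, fold j (p n)) 0 ≤ (∑ n ∈ Finset.range N, fold k (p n)) 0) :
    barycenter p N = mk (halfSpaceProj ((N : ℝ)⁻¹ • ∑ n ∈ Finset.range N, fold k (p n))) k := by
  set ν : Measure (OpenBook d K) := ∑ n ∈ Finset.range N, Measure.dirac (p n) with hν
  have huniv : ν Set.univ = N := by simp [hν]
  have hne : NeZero ν := ⟨fun h => by
    rw [h] at huniv
    simp only [Measure.coe_zero, Pi.zero_apply] at huniv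
    have : N = 0 := by exact_mod_cast huniv.symm
    omega⟩
  have h := isFrechetMean_mk_halfSpaceProj (ν := ν) (k := k) (integrable_sum_dirac _ p N)
    (by simpa only [hν, integral_sum_dirac] using hk)
  refine ((isBarycenter_iff p hN _).1 fun q => ?_).symm
  have hq := h q
  simp only [Measure.real, huniv, ENNReal.toReal_natCast] at hq
  simpa only [hν, integral_sum_dirac] using hq

theorem fold_barycenter (hN : 1 ≤ N) {k : Fin K}
    (hk : 0 < (∑ n ∈ Finset.range N, fold k (p n)) 0) :
    fold k (barycenter p N) = (N : ℝ)⁻¹ • ∑ n ∈ Finset.range N, fold k (p n) := by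
  rw [barycenter_eq_mk hN (k := k), fold_mk_self, halfSpaceProj_of_nonneg]
  · simpa using mul_nonneg (by positivity : (0 : ℝ) ≤ (N : ℝ)⁻¹) hk.le
  · intro j
    by_cases hjk : j = k
    · rw [hjk]
    · have h := integral_fold_zero_neg hjk (integrable_sum_dirac _ p N) (k := k)
      simp only [integral_sum_dirac] at h
      exact ((h hk).trans hk).le

/-- The events "the leaf `k` has the largest empirical first moment" form a finite measurable cover,
and on each of them `barycenter_eq_mk` gives a measurable formula. Ties are harmless: the formula is
valid for every maximizing leaf, so the events need not be disjoint. -/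
theorem measurable_barycenter [NeZero K] {Ω : Type*} [MeasurableSpace Ω] {X : ℕ → Ω → OpenBook d K}
    (hX : ∀ n, Measurable (X n)) (hN : 1 ≤ N) :
    Measurable fun ω => barycenter (fun n => X n ω) N := by
  set S : Fin K → Ω → Ambient d := fun k ω => ∑ n ∈ Finset.range N, fold k (X n ω) with hS
  have hSm : ∀ k, Measurable (S k) := fun k =>
    Finset.measurable_sum _ fun n _ => (lipschitzWith_fold k).continuous.measurable.comp (hX n)
  set A : Fin K → Set Ω := fun k => ⋂ j, {ω | S j ω 0 ≤ S k ω 0} with hA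
  have hAm : ∀ k, MeasurableSet (A k) := fun k => MeasurableSet.iInter fun j =>
    measurableSet_le ((EuclideanSpace.proj (𝕜 := ℝ) 0).continuous.measurable.comp (hSm j))
      ((EuclideanSpace.proj (𝕜 := ℝ) 0).continuous.measurable.comp (hSm k))
  have hcover : ⋃ k, A k = Set.univ := Set.eq_univ_of_forall fun ω => by
    obtain ⟨k, hk⟩ := Finite.exists_max fun k => S k ω 0
    exact Set.mem_iUnion.2 ⟨k, Set.mem_iInter.2 hk⟩
  set g : Fin K → Ω → OpenBook d K := fun k ω => mk (halfSpaceProj ((N : ℝ)⁻¹ • S k ω)) k with hg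
  have hgm : ∀ k, Measurable (g k) := fun k =>
    (continuous_mk k).measurable.comp (measurable_halfSpaceProj.comp ((hSm k).fun_const_smul _))
  have heq : ∀ k, ∀ ω ∈ A k, barycenter (fun n => X n ω) N = g k ω := fun k ω hω =>
    barycenter_eq_mk hN fun j => Set.mem_iInter.1 hω j
  intro B hB
  have hpre : (fun ω => barycenter (fun n => X n ω) N) ⁻¹' B = ⋃ k, A k ∩ g k ⁻¹' B := by
    ext ω
    obtain ⟨k, hk⟩ := Set.mem_iUnion.1 (hcover ▸ Set.mem_univ ω : ω ∈ ⋃ k, A k)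
    simp only [Set.mem_preimage, Set.mem_iUnion, Set.mem_inter_iff]
    exact ⟨fun h => ⟨k, hk, heq k ω hk ▸ h⟩, fun ⟨j, hj, h⟩ => heq j ω hj ▸ h⟩
  rw [hpre]
  exact MeasurableSet.iUnion fun k => (hAm k).inter (hgm k hB)

end Barycenter

end OpenBook

/-! ### Strong law and transfer of the central limit theorem to the barycenter. -/

namespace OpenBook

variable {d K : ℕ} {μ : Measure (OpenBook d K)} [IsProbabilityMeasure μ] {k : Fin K}
  {Ω : Type*} [MeasurableSpace Ω] {P : Measure Ω}
  {p : ℕ → Ω → OpenBook d K}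

theorem firstMoment_eq (hμ : Integrable (fun q => dist (origin k) q ^ 2) μ) :
    firstMoment μ k = (∫ q, fold k q ∂μ) 0 := by
  rw [firstMoment, foldedMeasure, integral_map (lipschitzWith_fold k).continuous.aemeasurable
    (by fun_prop), integral_fold_apply hμ]

/-- Identifies the covariance in the statement with the one that the central limit theorem produces,
by change of variables along `Y`. -/
theorem foldedCovariance_eq (hμ : Integrable (fun q => dist (origin k) q ^ 2) μ)
    {Y : Ω → OpenBook d K} (hY : Measurable Y) (hlaw : P.map Y = μ) :
    foldedCovariance μ k (∫ q, fold k q ∂μ) = covarianceMatrix P fun ω => fold k (Y ω) := by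
  have hf : Measurable (fold k : OpenBook d K → Ambient d) :=
    (lipschitzWith_fold k).continuous.measurable
  have hmean : ∀ i, ∫ ω, fold k (Y ω) i ∂P = (∫ q, fold k q ∂μ) i := fun i => by
    rw [integral_fold_apply hμ, ← hlaw, integral_map hY.aemeasurable]
    exact ((EuclideanSpace.proj (𝕜 := ℝ) i).continuous.measurable.comp hf).aestronglyMeasurable
  ext i j
  rw [foldedCovariance, covarianceMatrix, Matrix.of_apply, Matrix.of_apply, covariance,
    foldedMeasure, integral_map hf.aemeasurable (by fun_prop), hmean, hmean]
  -- Freezes the center, so that rewriting `μ` as a law affects only the outer integral.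
  generalize ∫ q, fold k q ∂μ = c
  rw [← hlaw, integral_map hY.aemeasurable]
  exact Measurable.aestronglyMeasurable
    ((((EuclideanSpace.proj (𝕜 := ℝ) i).continuous.measurable.comp hf).sub_const _).mul
      (((EuclideanSpace.proj (𝕜 := ℝ) j).continuous.measurable.comp hf).sub_const _))

/-- Almost surely, the folded barycenter is eventually the mean of the folded points. -/
theorem ae_eventually_fold_barycenter (hμ : Integrable (fun q => dist (origin k) q ^ 2) μ)
    (hk : 0 < (∫ q, fold k q ∂μ) 0) (hmeas : ∀ n, Measurable (p n)) (hindep : iIndepFun p P)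
    (hlaw : ∀ n, P.map (p n) = μ) :
    ∀ᵐ ω ∂P, ∀ᶠ N : ℕ in atTop, fold k (barycenter (fun n => p n ω) N) =
      (N : ℝ)⁻¹ • ∑ n ∈ Finset.range N, fold k (p n ω) := by
  have hf : Measurable (fold k : OpenBook d K → Ambient d) :=
    (lipschitzWith_fold k).continuous.measurable
  have hident : ∀ n, IdentDistrib (p n) (p 0) P P := fun n =>
    ⟨(hmeas n).aemeasurable, (hmeas 0).aemeasurable, by rw [hlaw, hlaw]⟩
  have hint : Integrable (fun ω => fold k (p 0 ω)) P := by
    have h : Integrable (fold k : OpenBook d K → Ambient d) (P.map (p 0)) := by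
      rw [hlaw]; exact integrable_fold hμ k
    exact h.comp_measurable (hmeas 0)
  have hmean : ∫ ω, fold k (p 0 ω) ∂P = ∫ q, fold k q ∂μ := by
    rw [← hlaw 0, integral_map (hmeas 0).aemeasurable hf.aestronglyMeasurable]
  have hslln := strong_law_ae (fun n ω => fold k (p n ω)) hint
    (fun i j hij => (hindep.indepFun hij).comp hf hf) (fun n => (hident n).comp hf)
  filter_upwards [hslln] with ω hω
  have h0 : Tendsto (fun N : ℕ => ((N : ℝ)⁻¹ • ∑ n ∈ Finset.range N, fold k (p n ω)) 0) atTop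
      (𝓝 ((∫ q, fold k q ∂μ) 0)) := by
    rw [← hmean]
    exact ((EuclideanSpace.proj (𝕜 := ℝ) (0 : Fin (d + 1))).continuous.tendsto _).comp hω
  -- The limit of the averages has positive first coordinate, so the averages eventually do too.
  filter_upwards [h0.eventually_const_lt hk, eventually_ge_atTop 1] with N hN hN1
  refine fold_barycenter hN1 ?_
  rw [PiLp.smul_apply, smul_eq_mul] at hN
  exact pos_of_mul_pos_right hN (by positivity)

variable [IsProbabilityMeasure P]

/-- The nonsticky central limit theorem, as convergence in distribution. -/
theorem tendstoInDistribution_fold_barycenter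
    (hμ : Integrable (fun q => dist (origin k) q ^ 2) μ) (hk : 0 < (∫ q, fold k q ∂μ) 0)
    (hmeas : ∀ n, Measurable (p n)) (hindep : iIndepFun p P) (hlaw : ∀ n, P.map (p n) = μ) :
    TendstoInDistribution
      (fun (N : ℕ) ω => √(N : ℝ) •
        (fold k (barycenter (fun n => p n ω) N) - fold k (frechetMean μ)))
      atTop id (fun _ => P)
      (multivariateGaussian 0 (foldedCovariance μ k (fold k (frechetMean μ)))) := by
  have : NeZero K := ⟨k.pos.ne'⟩
  have hf : Measurable (fold k : OpenBook d K → Ambient d) :=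
    (lipschitzWith_fold k).continuous.measurable
  have hident : ∀ n, IdentDistrib (p n) (p 0) P P := fun n =>
    ⟨(hmeas n).aemeasurable, (hmeas 0).aemeasurable, by rw [hlaw, hlaw]⟩
  have hmem : MemLp (fun ω => fold k (p 0 ω)) 2 P := by
    have h : MemLp (fold k : OpenBook d K → Ambient d) 2 (P.map (p 0)) := by
      rw [hlaw]; exact memLp_fold hμ k
    exact h.comp_of_map (hmeas 0).aemeasurable
  have hmean : ∫ ω, fold k (p 0 ω) ∂P = ∫ q, fold k q ∂μ := by
    rw [← hlaw 0, integral_map (hmeas 0).aemeasurable hf.aestronglyMeasurable]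
  have hclt := _root_.tendstoInDistribution_inv_sqrt_smul_sum_sub
    (X := fun n ω => fold k (p n ω)) hmem (hindep.comp (fun _ => fold k) fun _ => hf)
    (fun n => (hident n).comp hf)
  rw [← foldedCovariance_eq hμ (hmeas 0) (hlaw 0), hmean] at hclt
  rw [fold_frechetMean hμ hk]
  have hY : ∀ N : ℕ, AEMeasurable (fun ω => √(N : ℝ) •
      (fold k (barycenter (fun n => p n ω) N) - ∫ q, fold k q ∂μ)) P := by
    intro N
    -- At `N = 0` the barycenter is an arbitrary point, but the factor `√0` kills it.
    rcases Nat.eq_zero_or_pos N with rfl | hN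
    · simp
    · exact (((hf.comp (measurable_barycenter hmeas hN)).sub_const _).fun_const_smul _).aemeasurable
  -- Slutsky: it remains to see that the difference from the normalized sum tends to `0` in measure;
  -- almost surely it is eventually equal to `0`.
  refine tendstoInDistribution_of_tendstoInMeasure_sub _ _ hclt ?_ hY
  refine tendstoInMeasure_of_tendsto_ae
    (fun N => ((hY N).sub (hclt.forall_aemeasurable N)).aestronglyMeasurable) ?_
  filter_upwards [ae_eventually_fold_barycenter hμ hk hmeas hindep hlaw] with ω hω
  refine tendsto_const_nhds.congr' ?_
  filter_upwards [hω, eventually_ge_atTop 1] with N hN hN1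
  have hpos : (0 : ℝ) < N := by exact_mod_cast hN1
  have hsq : √(N : ℝ) * (N : ℝ)⁻¹ = (√(N : ℝ))⁻¹ := by
    rw [← div_eq_mul_inv, Real.sqrt_div_self', one_div]
  have hsq' : (√(N : ℝ))⁻¹ * N = √(N : ℝ) := by
    rw [mul_comm, ← div_eq_mul_inv, Real.div_sqrt]
  simp only [Pi.sub_apply, Pi.zero_apply, hN, smul_sub, smul_smul, hsq, hsq', sub_self]

end OpenBook

theorem mainTheorem3 {d K : ℕ} (hK : 3 ≤ K)
    (μ : Measure (OpenBook d K)) [IsProbabilityMeasure μ]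
    (hnondeg : ∀ j : Fin K, 0 < μ (OpenBook.openLeaf j))
    (k : Fin K)
    (hsq : Integrable (fun q => dist (OpenBook.origin k) q ^ 2) μ)
    (hk : 0 < OpenBook.firstMoment μ k)
    {Ω : Type*} [MeasurableSpace Ω] (P : Measure Ω) [IsProbabilityMeasure P]
    (p : ℕ → Ω → OpenBook d K) (hmeas : ∀ n, Measurable (p n))
    (hindep : iIndepFun p P) (hlaw : ∀ n, P.map (p n) = μ) :
    (∀ N : ℕ, 1 ≤ N → Measurable fun ω => OpenBook.barycenter (fun n => p n ω) N) ∧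
    ∀ φ : Ambient d →ᵇ ℝ,
      Tendsto
        (fun N : ℕ => ∫ x, φ x ∂(P.map fun ω =>
          √(N : ℝ) • (OpenBook.fold k (OpenBook.barycenter (fun n => p n ω) N)
            - OpenBook.fold k (OpenBook.frechetMean μ))))
        atTop
        (𝓝 (∫ x, φ x ∂(multivariateGaussian 0
          (OpenBook.foldedCovariance μ k (OpenBook.fold k (OpenBook.frechetMean μ)))))) := by
  have hk' : 0 < (∫ q, OpenBook.fold k q ∂μ) 0 := by rwa [← OpenBook.firstMoment_eq hsq]
  have : NeZero K := ⟨k.pos.ne'⟩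
  refine ⟨fun N hN => OpenBook.measurable_barycenter hmeas hN, fun φ => ?_⟩
  have h := OpenBook.tendstoInDistribution_fold_barycenter hsq hk' hmeas hindep hlaw
  simpa using ProbabilityMeasure.tendsto_iff_forall_integral_tendsto.1 h.tendsto φ
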